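/- Let $q$ be a prime power and let $X\subset\mathbb P^2$ be the Hermitian curve $y^qz+yz^q=x^{q+1}$ over $\mathbb F_{q^2}$, with rational points $P_1:=P_\infty=(0:1:0)$ and $P_2:=P_0=(0:0:1)$, and put $B:=X(\mathbb F_{q^2})\setminus\{P_0,P_\infty\}$. Let $d>2$ be an integer, let $0\le a_1\le a_2\le q$, and set $E:=a_1P_1+a_2P_2$. Let $r$ be the largest $i\in\{1,2\}$ with $a_i\le d-2+i$, and $r:=0$ if there is no such $i$. Set $d':=d-2+r$, $a'_i:=a_i$ for $1\le i\le r$, $a'_i:=0$ for $r<i\le 2$, and $E':=a'_1P_1+a'_2P_2$. Then $d'>0$, and the codes in $\mathbb F_{q^2}^B$ obtained by evaluating $H^0(X,\mathcal O_X(d)(-E))$ and $H^0(X,\mathcal O_X(d')(-E'))$ at the points of $B$ are the same code. Here the evaluation of a section of $\mathcal O_X(d)(-E)\subseteq\mathcal O_X(d)$ at $P\in B$ is made by choosing a homogeneous coordinate vector of $P$, that is, by identifying the fibre at $P$ with $\mathbb F_{q^2}$; so the code of a line bundle is defined up to multiplying, for each $P\in B$, the coordinate at $P$ of all codewords by a common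 nonzero scalar. "The same code" means: for all choices of coordinate vectors of the points of $B$ for the first code $C$ and for the second code $C'$, there are nonzero scalars $u_P\in\mathbb F_{q^2}$ $(P\in B)$ with $C=\{(u_Pc_P)_{P\in B} : (c_P)_{P\in B}\in C'\}$. -/

import Mathlib

noncomputable section

namespace Hermitian

open MvPolynomial
open scoped LinearAlgebra.Projectivization

variable (q : ℕ) (F : Type*) [Field F]

/-- The homogeneous equation `y^q z + y z^q - x^(q+1)` of the Hermitian curve, in the
homogeneous coordinates `x = X 0`, `y = X 1`, `z = X 2`. -/
def form : MvPolynomial (Fin 3) F :=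
  X 1 ^ q * X 2 + X 1 * X 2 ^ q - X 0 ^ (q + 1)

/-- The homogeneous coordinate ring `S` of the Hermitian curve. -/
abbrev CoordRing : Type _ := MvPolynomial (Fin 3) F ⧸ Ideal.span {form q F}

/-- The classes of the coordinates `x, y, z` in `S`. -/
def coord (i : Fin 3) : CoordRing q F := Ideal.Quotient.mk _ (X i)

/-- The graded piece of degree `n` of `S`. -/
def gradedPiece (n : ℕ) : Submodule F (CoordRing q F) :=
  (homogeneousSubmodule (Fin 3) F n).map
    (Ideal.Quotient.mkₐ F (Ideal.span {form q F})).toLinearMap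

variable {q F}

theorem gradedPiece_coord_pow_mul {n : ℕ} {f : CoordRing q F} (hf : f ∈ gradedPiece q F n)
    (i : Fin 3) (k : ℕ) : f * coord q F i ^ k ∈ gradedPiece q F (n + k) := by
  obtain ⟨p, hp, rfl⟩ := hf
  refine ⟨p * X i ^ k, ?_, by simp [coord]⟩
  have h1 : p.IsHomogeneous n := hp
  have h2 : (X i ^ k : MvPolynomial (Fin 3) F).IsHomogeneous (1 * k) :=
    (isHomogeneous_X F i).pow k
  rw [one_mul] at h2
  exact h1.mul h2

variable (q F)

/-- The ring `S` with `x_i` inverted; its degree `0` part is the coordinate ring of the affine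
chart `D₊(x_i)` of the curve. -/
abbrev Chart (i : Fin 3) : Type _ := Localization.Away (coord q F i)

/-- The ring `S` with `x_i x_j` inverted. -/
abbrev Overlap (i j : Fin 3) : Type _ := Localization.Away (coord q F i * coord q F j)

/-- Sections of `𝒪_X(d)` on the chart `D₊(x_i)`: the fractions `f / x_i^n` of degree `d`. -/
def twistedSections (d : ℕ) (i : Fin 3) : Submodule F (Chart q F i) where
  carrier := {s | ∃ n : ℕ, ∃ f ∈ gradedPiece q F (d + n),
    s * algebraMap (CoordRing q F) (Chart q F i) (coord q F i) ^ n =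
      algebraMap (CoordRing q F) (Chart q F i) f}
  zero_mem' := ⟨0, 0, Submodule.zero_mem _, by simp⟩
  add_mem' := by
    rintro s t ⟨n, f, hf, hs⟩ ⟨m, g, hg, ht⟩
    refine ⟨n + m, f * coord q F i ^ m + g * coord q F i ^ n, Submodule.add_mem _ ?_ ?_, ?_⟩
    · simpa only [add_assoc] using gradedPiece_coord_pow_mul hf i m
    · simpa only [add_assoc, add_comm m n] using gradedPiece_coord_pow_mul hg i n
    · simp only [map_add, map_mul, map_pow, ← hs, ← ht]
      ring
  smul_mem' := by
    rintro c s ⟨n, f, hf, hs⟩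
    refine ⟨n, c • f, Submodule.smul_mem _ _ hf, ?_⟩
    rw [smul_mul_assoc, hs]
    exact (map_smul (IsScalarTower.toAlgHom F (CoordRing q F) (Chart q F i)) c f).symm

/-- Restriction from `D₊(x_i)` to `D₊(x_i x_j)`. -/
def resLeft (i j : Fin 3) : Chart q F i →+* Overlap q F i j :=
  IsLocalization.Away.awayToAwayRight (coord q F i) (coord q F j)

/-- Restriction from `D₊(x_j)` to `D₊(x_i x_j)`. -/
def resRight (i j : Fin 3) : Chart q F j →+* Overlap q F i j :=
  IsLocalization.Away.awayToAwayLeft (coord q F j) (coord q F i)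

variable {q F} in
theorem resLeft_algebraMap (i j : Fin 3) (f : CoordRing q F) :
    resLeft q F i j (algebraMap _ _ f) = algebraMap _ _ f :=
  IsLocalization.Away.awayToAwayRight_eq _ _ _

variable {q F} in
theorem resRight_algebraMap (i j : Fin 3) (f : CoordRing q F) :
    resRight q F i j (algebraMap _ _ f) = algebraMap _ _ f :=
  IsLocalization.Away.awayToAwayLeft_eq _ _ _

/-- For a homogeneous ideal `I` of `S` with associated ideal sheaf `𝓘`, the space
`H⁰(X, 𝓘(d))` of global sections of the twist `𝓘(d) ⊆ 𝒪_X(d)`, in Čech form for the cover of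
`X` by `D₊(x)`, `D₊(y)`, `D₊(z)`: families of sections of `𝒪_X(d)` on the charts that lie in
the ideal sheaf and agree on the overlaps. -/
def globalSections (d : ℕ) (I : Ideal (CoordRing q F)) : Submodule F (∀ i, Chart q F i) where
  carrier := {s | (∀ i, s i ∈ twistedSections q F d i) ∧
    (∀ i, s i ∈ I.map (algebraMap (CoordRing q F) (Chart q F i))) ∧
    ∀ i j, resLeft q F i j (s i) = resRight q F i j (s j)}
  zero_mem' := ⟨fun _ => Submodule.zero_mem _, fun _ => Submodule.zero_mem _, by simp⟩
  add_mem' := by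
    rintro s t ⟨h1, h2, h3⟩ ⟨k1, k2, k3⟩
    exact ⟨fun i => Submodule.add_mem _ (h1 i) (k1 i), fun i => Submodule.add_mem _ (h2 i) (k2 i),
      fun i j => by simp [h3, k3]⟩
  smul_mem' := by
    rintro c s ⟨h1, h2, h3⟩
    refine ⟨fun i => Submodule.smul_mem _ _ (h1 i), fun i => ?_, fun i j => ?_⟩
    · rw [Pi.smul_apply, Algebra.smul_def]
      exact Ideal.mul_mem_left _ _ (h2 i)
    · rw [Pi.smul_apply, Pi.smul_apply, Algebra.smul_def, Algebra.smul_def, map_mul, map_mul, h3,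
        IsScalarTower.algebraMap_apply F (CoordRing q F) (Chart q F i),
        IsScalarTower.algebraMap_apply F (CoordRing q F) (Chart q F j),
        resLeft_algebraMap, resRight_algebraMap]

/-- Homogeneous coordinate vectors of the `F`-rational points of the curve. -/
structure CoordVector where
  /-- the vector -/
  vec : Fin 3 → F
  ne_zero : vec ≠ 0
  on_curve : eval vec (form q F) = 0

variable {q F}

/-- The point of the projective plane with the given homogeneous coordinates. -/
def CoordVector.point (v : CoordVector q F) : ℙ F (Fin 3 → F) :=
  Projectivization.mk F v.vec v.ne_zero

/-- The value of an element of `S` at a coordinate vector. -/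
def CoordVector.eval (v : CoordVector q F) : CoordRing q F →+* F :=
  Ideal.Quotient.lift _ (MvPolynomial.eval v.vec) fun p hp => by
    obtain ⟨r, rfl⟩ := Ideal.mem_span_singleton.1 hp
    rw [map_mul, v.on_curve, zero_mul]

theorem CoordVector.eval_coord (v : CoordVector q F) (i : Fin 3) :
    v.eval (coord q F i) = v.vec i := by
  simp [CoordVector.eval, coord]

/-- The value of a fraction `f / x_i^n` at a coordinate vector `v` with `v_i ≠ 0`. -/
def CoordVector.evalChart (v : CoordVector q F) (i : Fin 3) (hi : v.vec i ≠ 0) :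
    Chart q F i →+* F :=
  IsLocalization.Away.lift (coord q F i) (g := v.eval)
    (by rw [v.eval_coord]; exact hi.isUnit)

theorem CoordVector.evalChart_algebraMap (v : CoordVector q F) (i : Fin 3) (hi : v.vec i ≠ 0)
    (f : CoordRing q F) : v.evalChart i hi (algebraMap _ _ f) = v.eval f :=
  IsLocalization.Away.lift_eq _ _ _

theorem CoordVector.exists_ne (v : CoordVector q F) : ∃ i, v.vec i ≠ 0 := by
  by_contra! h
  exact v.ne_zero (funext h)

/-- The value of a global section of `𝓘(d) ⊆ 𝒪_X(d)` at a coordinate vector `v`, computed in a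
chart containing the point; by `sectionEval_eq` it does not depend on the chart. (The choice of
the vector `v` representing the point `P` amounts to an identification of the fibre of `𝒪_X(d)`
at `P` with `F`.) -/
def sectionEval (d : ℕ) (I : Ideal (CoordRing q F)) (v : CoordVector q F) :
    globalSections q F d I →ₗ[F] F where
  toFun s := v.evalChart v.exists_ne.choose v.exists_ne.choose_spec (s.1 v.exists_ne.choose)
  map_add' s t := by simp
  map_smul' c s := by
    simp only [Submodule.coe_smul, Pi.smul_apply, Algebra.smul_def, map_mul, RingHom.id_apply,
      Algebra.algebraMap_self_apply]
    rw [IsScalarTower.algebraMap_apply F (CoordRing q F) (Chart q F _),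
      CoordVector.evalChart_algebraMap]
    congr 1
    exact MvPolynomial.eval_C c

theorem sectionEval_eq (d : ℕ) (I : Ideal (CoordRing q F)) (v : CoordVector q F)
    (s : globalSections q F d I) (i : Fin 3) (hi : v.vec i ≠ 0) :
    sectionEval d I v s = v.evalChart i hi (s.1 i) := by
  set j := v.exists_ne.choose with hj
  have hj' : v.vec j ≠ 0 := v.exists_ne.choose_spec
  have hu : IsUnit (v.eval (coord q F i * coord q F j)) := by
    rw [map_mul, v.eval_coord, v.eval_coord]
    exact (mul_ne_zero hi hj').isUnit
  let e : Overlap q F i j →+* F :=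
    IsLocalization.Away.lift (coord q F i * coord q F j) (g := v.eval) hu
  have he : ∀ f, e (algebraMap _ _ f) = v.eval f := fun f => IsLocalization.Away.lift_eq _ _ _
  have h1 : e.comp (resLeft q F i j) = v.evalChart i hi :=
    IsLocalization.ringHom_ext (Submonoid.powers (coord q F i)) (by
      ext f <;> simp [he, resLeft_algebraMap, v.evalChart_algebraMap])
  have h2 : e.comp (resRight q F i j) = v.evalChart j hj' :=
    IsLocalization.ringHom_ext (Submonoid.powers (coord q F j)) (by
      ext f <;> simp [he, resRight_algebraMap, v.evalChart_algebraMap])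
  have h3 := s.2.2.2 i j
  change v.evalChart j hj' (s.1 j) = _
  rw [← h1, ← h2, RingHom.comp_apply, RingHom.comp_apply, h3]

variable (q F)

/-- The point `P_∞ = (0 : 1 : 0)`. -/
def pInfty : ℙ F (Fin 3 → F) :=
  Projectivization.mk F ![0, 1, 0] fun h => one_ne_zero (α := F) (congrFun h 1)

/-- The point `P_0 = (0 : 0 : 1)`. -/
def pZero : ℙ F (Fin 3 → F) :=
  Projectivization.mk F ![0, 0, 1] fun h => one_ne_zero (α := F) (congrFun h 2)

/-- The set `X(F)` of rational points of the Hermitian curve. -/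
def rationalPoints : Set (ℙ F (Fin 3 → F)) := Set.range (CoordVector.point (q := q) (F := F))

/-- `B = X(F) \ {P_0, P_∞}`. -/
def B : Set (ℙ F (Fin 3 → F)) := rationalPoints q F \ {pZero F, pInfty F}

/-- The homogeneous ideal of `P_∞` in `S`. -/
def idealInfty : Ideal (CoordRing q F) := Ideal.span {coord q F 0, coord q F 2}

/-- The homogeneous ideal of `P_0` in `S`. -/
def idealZero : Ideal (CoordRing q F) := Ideal.span {coord q F 0, coord q F 1}

/-- A homogeneous ideal whose ideal sheaf is `𝒪_X(-E)` for the divisor `E = a P_∞ + b P_0`. -/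
def divisorIdeal (a b : ℕ) : Ideal (CoordRing q F) := idealInfty q F ^ a * idealZero q F ^ b

variable {q F}

/-- The code obtained by evaluating `H⁰(X, 𝒪_X(d)(-E))`, `E = a P_∞ + b P_0`, on `B`, the points
`P` of `B` being represented by the coordinate vectors `v P`. -/
def code (d a b : ℕ) (v : B q F → CoordVector q F) : Submodule F (B q F → F) :=
  LinearMap.range (LinearMap.pi fun P => sectionEval d (divisorIdeal q F a b) (v P))

/-- The largest `i ∈ {1, 2}` with `a i ≤ d - 2 + i`, and `0` if there is none. -/
def rIndex (d : ℕ) (a : ℕ → ℕ) : ℕ := Nat.findGreatest (fun i => 1 ≤ i ∧ a i ≤ d - 2 + i) 2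

/-- The multiplicities `a'_i`: the first `r` of the `a_i` are kept, the others become `0`. -/
def truncate (r : ℕ) (a : ℕ → ℕ) (i : ℕ) : ℕ := if i ≤ r then a i else 0

end Hermitian

end

noncomputable section

namespace Hermitian

open MvPolynomial
open scoped LinearAlgebra.Projectivization

attribute [local instance] MvPolynomial.gradedAlgebra

/-! The tangent to the curve at `P_0` is `y = 0` and the tangent at `P_∞` is `z = 0`; each meets the
curve at that point only, with multiplicity `q + 1`. A form of degree `n` vanishing at `P_0` to
order `b` with `n < b ≤ q` restricts to zero on the tangent (Bézout), so on the curve it is `y`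
times a form of degree `n - 1` (`exists_eq_coord_mul`). Since `y` vanishes at `P_0` to order at
least `b` and nowhere else on the curve, the cofactor keeps only the condition at `P_∞`; likewise
for `z`. As `y` and `z` have no zeros on `B`, each division only rescales the coordinates of the
code (`exists_units_code_iff`). Thus if `a_2 > d`, the condition at `P_0` is traded for one degree,
and if moreover `a_1 > d - 1`, so is the one at `P_∞`.

Global sections are reduced to forms by `exists_form_of_globalSections`, which rests on `y, z` being
a regular sequence in `S`. -/

/-! ### Restriction to a coordinate line, and homogeneity. -/

/-- The substitution `x_j = 0`. -/
def killVar {F : Type*} [Field F] (j : Fin 3) :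
    MvPolynomial (Fin 3) F →ₐ[F] MvPolynomial (Fin 3) F :=
  aeval fun i => if i = j then 0 else X i

variable {F : Type*} [Field F]

theorem killVar_X_self (j : Fin 3) : killVar j (X j : MvPolynomial (Fin 3) F) = 0 := by
  simp [killVar]

theorem killVar_X_of_ne {i j : Fin 3} (h : i ≠ j) :
    killVar j (X i : MvPolynomial (Fin 3) F) = X i := by
  simp [killVar, h]

theorem X_dvd_sub_killVar (j : Fin 3) (p : MvPolynomial (Fin 3) F) : X j ∣ p - killVar j p := by
  rw [← Ideal.mem_span_singleton, ← Ideal.Quotient.mk_eq_mk_iff_sub_mem]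
  have h : Ideal.Quotient.mkₐ F (Ideal.span {(X j : MvPolynomial (Fin 3) F)}) =
      (Ideal.Quotient.mkₐ F (Ideal.span {(X j : MvPolynomial (Fin 3) F)})).comp (killVar j) := by
    ext i
    by_cases hi : i = j
    · subst hi
      simp [killVar_X_self]
    · simp [killVar_X_of_ne hi]
  exact DFunLike.congr_fun h p

theorem X_dvd_iff_killVar_eq_zero (j : Fin 3) (p : MvPolynomial (Fin 3) F) :
    X j ∣ p ↔ killVar j p = 0 := by
  constructor
  · rintro ⟨r, rfl⟩
    rw [map_mul, killVar_X_self, zero_mul]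
  · intro h
    simpa [h] using X_dvd_sub_killVar j p

theorem isHomogeneous_killVar {p : MvPolynomial (Fin 3) F} {n : ℕ} (hp : p.IsHomogeneous n)
    (j : Fin 3) : (killVar j p).IsHomogeneous n := by
  have := hp.aeval (S := F) (fun i => if i = j then 0 else X i) (n := 1) fun i => by
    split_ifs
    · exact isHomogeneous_zero _ _ _
    · exact isHomogeneous_X _ _
  rwa [one_mul] at this

theorem eq_zero_of_isHomogeneous_of_X_pow_dvd {p : MvPolynomial (Fin 3) F} {n b : ℕ}
    (hp : p.IsHomogeneous n) (hb : n < b) {i : Fin 3} (h : X i ^ b ∣ p) : p = 0 := by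
  by_contra h0
  obtain ⟨r, rfl⟩ := h
  have hr : r ≠ 0 := right_ne_zero_of_mul h0
  have := hp.totalDegree h0
  rw [totalDegree_mul_of_isDomain (left_ne_zero_of_mul h0) hr, totalDegree_X_pow] at this
  omega

theorem isHomogeneous_of_mul {p r : MvPolynomial (Fin 3) F} {m n : ℕ}
    (h : (p * r).IsHomogeneous (n + m)) (hp : p.IsHomogeneous n) (h0 : p ≠ 0) :
    r.IsHomogeneous m := by
  have h1 : (DirectSum.decompose (homogeneousSubmodule (Fin 3) F) (p * r) (n + m) :
      MvPolynomial (Fin 3) F) = p * r := DirectSum.decompose_of_mem_same _ h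
  rw [DirectSum.coe_decompose_mul_add_of_left_mem _ hp] at h1
  rw [← mul_left_cancel₀ h0 h1]
  exact SetLike.coe_mem (DirectSum.decompose (homogeneousSubmodule (Fin 3) F) r m)

theorem eval_smul_of_isHomogeneous {p : MvPolynomial (Fin 3) F} {n : ℕ} (hp : p.IsHomogeneous n)
    (c : F) (v : Fin 3 → F) : eval (c • v) p = c ^ n * eval v p := by
  rw [eval_eq, eval_eq, Finset.mul_sum]
  refine Finset.sum_congr rfl fun m hm => ?_
  have := hp (mem_support_iff.1 hm)
  simp only [Pi.smul_apply, smul_eq_mul, mul_pow, Finset.prod_mul_distrib]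
  rw [Finset.prod_pow_eq_pow_sum]
  have h2 : ∑ i ∈ m.support, m i = n := by
    rw [← this, Finsupp.weight_apply, Finsupp.sum]; simp
  rw [h2]; ring

/-! ### The regular sequence `y, z` in the coordinate ring. -/

variable {q : ℕ}

theorem isHomogeneous_form (q : ℕ) : (form q F).IsHomogeneous (q + 1) := by
  have h (i : Fin 3) := isHomogeneous_X F i
  refine IsHomogeneous.sub (IsHomogeneous.add ?_ ?_) ?_
  · simpa using ((h 1).pow q).mul (h 2)
  · simpa [add_comm] using (h 1).mul ((h 2).pow q)
  · simpa using (h 0).pow (q + 1)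

theorem killVar_form (hq : q ≠ 0) {j : Fin 3} (hj : j ≠ 0) :
    killVar j (form q F) = -X 0 ^ (q + 1) := by
  fin_cases j
  · simp at hj
  · simp [form, killVar, hq]
  · simp [form, killVar, hq]

theorem X_dvd_of_dvd_mul_form (hq : q ≠ 0) {j : Fin 3} (hj : j ≠ 0)
    {p : MvPolynomial (Fin 3) F} (h : X j ∣ form q F * p) : X j ∣ p := by
  rw [X_dvd_iff_killVar_eq_zero, map_mul, killVar_form hq hj] at h
  rw [X_dvd_iff_killVar_eq_zero]
  simpa using h

theorem mk_eq_zero_iff {p : MvPolynomial (Fin 3) F} :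
    (Ideal.Quotient.mk (Ideal.span {form q F}) p) = 0 ↔ form q F ∣ p := by
  rw [Ideal.Quotient.eq_zero_iff_mem, Ideal.mem_span_singleton]

/-- The form restricts to `-x^(q+1) ≠ 0` on the line `x_j = 0`, so `X j` can be cancelled modulo the
form; irreducibility of the curve is not needed. -/
theorem coord_mul_left_cancel (hq : q ≠ 0) {j : Fin 3} (hj : j ≠ 0) {f g : CoordRing q F}
    (h : coord q F j * f = coord q F j * g) : f = g := by
  rw [← sub_eq_zero] at h ⊢
  rw [← mul_sub] at h
  generalize f - g = a at h
  obtain ⟨p, rfl⟩ := Ideal.Quotient.mk_surjective a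
  rw [coord, ← map_mul, mk_eq_zero_iff] at h
  obtain ⟨r, hr⟩ := h
  obtain ⟨s, rfl⟩ := X_dvd_of_dvd_mul_form hq hj (Dvd.intro _ hr)
  rw [mk_eq_zero_iff]
  refine ⟨s, mul_left_cancel₀ (X_ne_zero (R := F) j) ?_⟩
  rw [hr]; ring

theorem coord_pow_mul_left_cancel (hq : q ≠ 0) {j : Fin 3} (hj : j ≠ 0) (n : ℕ)
    {f g : CoordRing q F} (h : coord q F j ^ n * f = coord q F j ^ n * g) : f = g := by
  induction n with
  | zero => simpa using h
  | succ n ih =>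
    refine ih (coord_mul_left_cancel hq hj ?_)
    rw [← mul_assoc, ← mul_assoc, ← pow_succ', h]

/-- Modulo `x_j` the ring `S` becomes `F[x_0, x_k]/(x_0^(q+1))`, where `x_k` is a nonzerodivisor. -/
theorem coord_dvd_of_dvd_coord_mul (hq : q ≠ 0) {j k : Fin 3} (hj : j ≠ 0) (hk : k ≠ 0)
    (hjk : j ≠ k) {f : CoordRing q F} (h : coord q F j ∣ coord q F k * f) : coord q F j ∣ f := by
  obtain ⟨p, rfl⟩ := Ideal.Quotient.mk_surjective f
  obtain ⟨g, hg⟩ := h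
  obtain ⟨r, rfl⟩ := Ideal.Quotient.mk_surjective g
  rw [coord, coord, ← map_mul, ← map_mul, ← sub_eq_zero, ← map_sub, mk_eq_zero_iff] at hg
  obtain ⟨c, hc⟩ := hg
  have h1 := congrArg (killVar j) hc
  simp only [map_sub, map_mul, killVar_X_self, killVar_X_of_ne hjk.symm, killVar_form hq hj,
    zero_mul, sub_zero] at h1
  have h2 : X 0 ^ (q + 1) ∣ killVar j p := by
    refine X_prime.pow_dvd_of_dvd_mul_left _ (b := killVar j p) (a := X k) ?_ ?_
    · rw [X_dvd_X]; exact hk.symm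
    · rw [h1, neg_mul]; exact (Dvd.intro _ rfl).neg_right
  obtain ⟨e, he⟩ := h2
  obtain ⟨t, ht⟩ := X_dvd_sub_killVar j p
  have h3 := X_dvd_sub_killVar j (form q F)
  rw [killVar_form hq hj] at h3
  obtain ⟨w, hw⟩ := h3
  -- Modulo `X j`, `p` is `X 0 ^ (q + 1) * e`, and `X 0 ^ (q + 1)` is `-form`.
  have h4 : p = X j * (t + w * e) - form q F * e := by
    linear_combination ht + he + e * hw
  refine ⟨Ideal.Quotient.mk _ (t + w * e), ?_⟩
  rw [coord, ← map_mul, ← sub_eq_zero, ← map_sub, mk_eq_zero_iff]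
  exact ⟨-e, by linear_combination h4⟩

theorem coord_dvd_of_dvd_coord_pow_mul (hq : q ≠ 0) {j k : Fin 3} (hj : j ≠ 0) (hk : k ≠ 0)
    (hjk : j ≠ k) (m : ℕ) {f : CoordRing q F} (h : coord q F j ∣ coord q F k ^ m * f) :
    coord q F j ∣ f := by
  induction m with
  | zero => simpa using h
  | succ m ih =>
    refine ih (coord_dvd_of_dvd_coord_mul hq hj hk hjk ?_)
    rwa [← mul_assoc, ← pow_succ']

theorem coord_pow_dvd_of_dvd_coord_pow_mul (hq : q ≠ 0) {j k : Fin 3} (hj : j ≠ 0) (hk : k ≠ 0)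
    (hjk : j ≠ k) (m n : ℕ) {f : CoordRing q F} (h : coord q F j ^ n ∣ coord q F k ^ m * f) :
    coord q F j ^ n ∣ f := by
  induction n generalizing f with
  | zero => simp
  | succ n ih =>
    obtain ⟨g, rfl⟩ := coord_dvd_of_dvd_coord_pow_mul hq hj hk hjk m
      ((dvd_pow_self _ n.succ_ne_zero).trans h)
    rw [pow_succ']
    refine mul_dvd_mul_left _ (ih ?_)
    obtain ⟨c, hc⟩ := h
    refine ⟨c, coord_mul_left_cancel hq hj ?_⟩
    linear_combination hc

theorem mem_gradedPiece_of_coord_pow_mul (hq : q ≠ 0) {j : Fin 3} (hj : j ≠ 0) (n d : ℕ)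
    {h : CoordRing q F} (hh : coord q F j ^ n * h ∈ gradedPiece q F (d + n)) :
    h ∈ gradedPiece q F d := by
  obtain ⟨p, hp, hpe⟩ := hh
  obtain ⟨r, rfl⟩ := Ideal.Quotient.mk_surjective h
  replace hpe : Ideal.Quotient.mk (Ideal.span {form q F}) p = _ := hpe
  rw [coord, ← map_pow, ← map_mul, Ideal.Quotient.eq] at hpe
  have hom : (Ideal.span {form q F}).IsHomogeneous (homogeneousSubmodule (Fin 3) F) :=
    Ideal.homogeneous_span _ _ fun x hx => ⟨q + 1, by
      rw [Set.mem_singleton_iff.1 hx]; exact isHomogeneous_form q⟩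
  -- In degree `d + n` the congruence involves only the degree `d` component of `r`, which therefore
  -- represents `h` as well.
  have h1 := hom (d + n) hpe
  have hX : (X j ^ n : MvPolynomial (Fin 3) F) ∈ homogeneousSubmodule (Fin 3) F n := by
    simpa using (isHomogeneous_X F j).pow n
  rw [DirectSum.decompose_sub, DirectSum.sub_apply, AddSubgroupClass.coe_sub,
    DirectSum.decompose_of_mem_same _ hp, add_comm d n,
    DirectSum.coe_decompose_mul_add_of_left_mem _ hX, ← Ideal.Quotient.eq] at h1
  refine ⟨_, SetLike.coe_mem (DirectSum.decompose (homogeneousSubmodule (Fin 3) F) r d), ?_⟩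
  refine coord_pow_mul_left_cancel hq hj n ?_
  rw [← Ideal.Quotient.eq] at hpe
  change _ * Ideal.Quotient.mk (Ideal.span {form q F}) _ = _
  rw [coord, ← map_pow, ← map_mul, ← h1, hpe, map_mul]

/-! ### Global sections as saturated forms. -/

/-- The forms of degree `d` on the curve that lie in the saturation of the ideal `I`. -/
def saturatedForms (d : ℕ) (I : Ideal (CoordRing q F)) : Set (CoordRing q F) :=
  {h | h ∈ gradedPiece q F d ∧ ∀ i, ∃ N : ℕ, coord q F i ^ N * h ∈ I}

theorem algebraMap_mem_map_iff {I : Ideal (CoordRing q F)} {i : Fin 3} {h : CoordRing q F} :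
    algebraMap _ (Chart q F i) h ∈ I.map (algebraMap (CoordRing q F) (Chart q F i)) ↔
      ∃ N : ℕ, coord q F i ^ N * h ∈ I := by
  rw [IsLocalization.algebraMap_mem_map_algebraMap_iff (Submonoid.powers (coord q F i))]
  simp [Submonoid.mem_powers_iff]

theorem exists_pow_mul_eq_of_overlap {i j : Fin 3} {f g : CoordRing q F}
    (h : algebraMap _ (Overlap q F i j) f = algebraMap _ (Overlap q F i j) g) :
    ∃ N : ℕ, coord q F i ^ N * (coord q F j ^ N * f) = coord q F i ^ N * (coord q F j ^ N * g) := by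
  rw [IsLocalization.eq_iff_exists (Submonoid.powers (coord q F i * coord q F j))] at h
  obtain ⟨⟨_, N, rfl⟩, h⟩ := h
  exact ⟨N, by simpa only [mul_pow, mul_assoc] using h⟩

/-- A global section of a twist of the structure sheaf is given by a form. -/
theorem exists_form_of_globalSections (hq : q ≠ 0) {d : ℕ} {I : Ideal (CoordRing q F)}
    {s : ∀ i, Chart q F i} (hs : s ∈ globalSections q F d I) :
    ∃ h ∈ saturatedForms d I, ∀ i, s i = algebraMap _ _ h := by
  obtain ⟨h1, h2, h3⟩ := hs
  obtain ⟨n, f, hf, hsf⟩ := h1 1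
  obtain ⟨m, g, hg, hsg⟩ := h1 2
  -- The fractions `f / y^n` and `g / z^m` agree on `D₊(yz)`. Regularity of `y, z` then makes `y^n`
  -- divide `f`, and the quotient is the form sought.
  have key : coord q F 2 ^ m * f = coord q F 1 ^ n * g := by
    have e1 := congrArg (resLeft q F 1 2) hsf
    have e2 := congrArg (resRight q F 1 2) hsg
    simp only [map_mul, map_pow, resLeft_algebraMap, resRight_algebraMap] at e1 e2
    obtain ⟨N, hN⟩ := exists_pow_mul_eq_of_overlap (i := 1) (j := 2)
      (f := coord q F 2 ^ m * f) (g := coord q F 1 ^ n * g) (by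
        simp only [map_mul, map_pow, ← e1, ← e2, h3 1 2]
        ring)
    exact coord_pow_mul_left_cancel hq (by decide) N (coord_pow_mul_left_cancel hq (by decide) N hN)
  obtain ⟨h, rfl⟩ := coord_pow_dvd_of_dvd_coord_pow_mul hq (j := 1) (k := 2) (by decide)
    (by decide) (by decide) m n (Dvd.intro _ key.symm)
  have hh := mem_gradedPiece_of_coord_pow_mul hq (by decide) n d hf
  have hs1 : s 1 = algebraMap _ _ h := by
    rw [map_mul, map_pow, mul_comm] at hsf
    exact ((IsLocalization.Away.algebraMap_isUnit (coord q F 1)).pow n).mul_left_cancel hsf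
  have hs (i : Fin 3) : s i = algebraMap _ _ h := by
    obtain ⟨k, e, -, hse⟩ := h1 i
    have e1 := congrArg (resLeft q F i 1) hse
    simp only [map_mul, map_pow, resLeft_algebraMap, h3 i 1, hs1, resRight_algebraMap] at e1
    obtain ⟨N, hN⟩ := exists_pow_mul_eq_of_overlap (i := i) (j := 1)
      (f := h * coord q F i ^ k) (g := e) (by simpa only [map_mul, map_pow] using e1)
    -- Only the power of `y` is cancelled in `S`; powers of `x_i` are cancelled later in the chart,
    -- where they are units, so this also covers `i = 0`.
    have hN' : coord q F i ^ N * (h * coord q F i ^ k) = coord q F i ^ N * e := by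
      refine coord_pow_mul_left_cancel hq (j := 1) (by decide) N ?_
      linear_combination hN
    have hN'' := congrArg (algebraMap _ (Chart q F i)) hN'
    simp only [map_mul, map_pow, ← hse] at hN''
    have hu := IsLocalization.Away.algebraMap_isUnit (S := Chart q F i) (coord q F i)
    exact ((hu.pow k).mul_right_cancel ((hu.pow N).mul_left_cancel hN'')).symm
  refine ⟨h, ⟨hh, fun i => ?_⟩, hs⟩
  rw [← algebraMap_mem_map_iff, ← hs i]
  exact h2 i

theorem algebraMap_mem_globalSections {d : ℕ} {I : Ideal (CoordRing q F)} {h : CoordRing q F}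
    (hh : h ∈ saturatedForms d I) :
    (fun i => algebraMap _ (Chart q F i) h) ∈ globalSections q F d I :=
  ⟨fun i => ⟨0, h, hh.1, by simp⟩, fun i => algebraMap_mem_map_iff.2 (hh.2 i),
    fun i j => by rw [resLeft_algebraMap, resRight_algebraMap]⟩

theorem sectionEval_of_eq {d : ℕ} {I : Ideal (CoordRing q F)} (v : CoordVector q F)
    (s : globalSections q F d I) {h : CoordRing q F} (hs : ∀ i, s.1 i = algebraMap _ _ h) :
    sectionEval d I v s = v.eval h := by
  obtain ⟨i, hi⟩ := v.exists_ne
  rw [sectionEval_eq d I v s i hi, hs, v.evalChart_algebraMap]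

theorem mem_code_iff (hq : q ≠ 0) {d a b : ℕ} {v : B q F → CoordVector q F} {c : B q F → F} :
    c ∈ code d a b v ↔ ∃ h ∈ saturatedForms d (divisorIdeal q F a b), ∀ P, (v P).eval h = c P := by
  constructor
  · rintro ⟨s, rfl⟩
    obtain ⟨h, hh, hs⟩ := exists_form_of_globalSections hq s.2
    exact ⟨h, hh, fun P => (sectionEval_of_eq (v P) s hs).symm⟩
  · rintro ⟨h, hh, hc⟩
    refine ⟨⟨_, algebraMap_mem_globalSections hh⟩, funext fun P => ?_⟩
    rw [← hc P]
    exact sectionEval_of_eq (v P) ⟨_, algebraMap_mem_globalSections hh⟩ fun i => rfl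

/-! ### Dividing by the tangent lines. -/

/-- A form of degree `e` vanishing to order `b > e` at the point `x_0 = x_j = 0` is divisible
by the equation `x_j` of the tangent line, provided that `b ≤ q`. -/
theorem exists_eq_coord_mul (hq : q ≠ 0) {j k : Fin 3} (hj : j ≠ 0) (hk : k ≠ 0) (hjk : j ≠ k)
    {e b N : ℕ} (heb : e + 1 < b) (hb : b ≤ q) {h : CoordRing q F}
    (hh : h ∈ gradedPiece q F (e + 1))
    (hN : coord q F k ^ N * h ∈ Ideal.span {coord q F 0, coord q F j} ^ b) :
    ∃ g ∈ gradedPiece q F e, h = coord q F j * g := by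
  obtain ⟨p, hp, rfl⟩ := hh
  change coord q F k ^ N * Ideal.Quotient.mk (Ideal.span {form q F}) p ∈ _ at hN
  have h1 : Ideal.span {coord q F 0, coord q F j} =
      (Ideal.span {X 0, X j}).map (Ideal.Quotient.mk (Ideal.span {form q F})) := by
    rw [Ideal.map_span, Set.image_pair]; rfl
  rw [h1, ← Ideal.map_pow, coord, ← map_pow, ← map_mul, Ideal.mem_quotient_iff_mem_sup] at hN
  -- On the tangent line the order of vanishing is read off as a power of `X 0`; the form causes no
  -- loss, as it becomes `-X 0 ^ (q + 1)` and `b ≤ q`.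
  have h2 : Ideal.span {X 0, X j} ^ b ⊔ Ideal.span {form q F} ≤
      (Ideal.span {X 0 ^ b}).comap (killVar (F := F) j) := by
    refine sup_le ?_ ?_
    · rw [← Ideal.map_le_iff_le_comap, Ideal.map_pow, ← Ideal.span_singleton_pow]
      refine Ideal.pow_right_mono ?_ b
      rw [Ideal.map_le_iff_le_comap, Ideal.span_le]
      rintro x (rfl | rfl)
      · simp [killVar_X_of_ne hj.symm]
      · simp [killVar_X_self]
    · rw [Ideal.span_singleton_le_iff_mem, Ideal.mem_comap, killVar_form hq hj,
        Ideal.mem_span_singleton]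
      exact (pow_dvd_pow _ (by omega)).neg_right
  have h3 := h2 hN
  rw [Ideal.mem_comap, Ideal.mem_span_singleton, map_mul, map_pow, killVar_X_of_ne hjk.symm] at h3
  have h4 : X 0 ^ b ∣ killVar j p :=
    X_prime.pow_dvd_of_dvd_mul_left _
      (fun h => hk (X_dvd_X.1 (X_prime.dvd_of_dvd_pow h)).symm) h3
  obtain ⟨r, rfl⟩ := (X_dvd_iff_killVar_eq_zero j p).2
    (eq_zero_of_isHomogeneous_of_X_pow_dvd (isHomogeneous_killVar hp j) heb h4)
  refine ⟨Ideal.Quotient.mk _ r, ⟨r, ?_, rfl⟩, by simp [coord]⟩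
  exact isHomogeneous_of_mul (n := 1) (by rw [add_comm 1 e]; exact hp) (isHomogeneous_X F j)
    (X_ne_zero j)

theorem coord_mul_mem_gradedPiece (j : Fin 3) {e : ℕ} {g : CoordRing q F}
    (hg : g ∈ gradedPiece q F e) : coord q F j * g ∈ gradedPiece q F (e + 1) := by
  simpa [mul_comm] using gradedPiece_coord_pow_mul hg j 1

theorem form_relation :
    coord q F 1 ^ q * coord q F 2 + coord q F 1 * coord q F 2 ^ q = coord q F 0 ^ (q + 1) := by
  rw [← sub_eq_zero]
  simp only [coord, ← map_pow, ← map_mul, ← map_add, ← map_sub]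
  exact Ideal.Quotient.eq_zero_iff_mem.2 (Ideal.mem_span_singleton_self _)

/-- The equation of the tangent line at `P_0` vanishes there to order at least `q`. -/
theorem exists_coord_pow_mul_coord_one_mem {b : ℕ} (hb : b ≤ q) (i : Fin 3) :
    ∃ N : ℕ, coord q F i ^ N * coord q F 1 ∈ idealZero q F ^ b := by
  have m0 : coord q F 0 ∈ idealZero q F := Ideal.subset_span (by simp)
  have m1 : coord q F 1 ∈ idealZero q F := Ideal.subset_span (by simp)
  -- `P_0` lies outside `D₊(x)` and `D₊(y)`, where its ideal is the unit ideal; on `D₊(z)` the curve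
  -- equation expresses `z^q y`.
  fin_cases i
  · exact ⟨b, Ideal.mul_mem_right _ _ (Ideal.pow_mem_pow m0 b)⟩
  · exact ⟨b, Ideal.mul_mem_right _ _ (Ideal.pow_mem_pow m1 b)⟩
  · refine ⟨q, Ideal.pow_le_pow_right hb ?_⟩
    have : coord q F 2 ^ q * coord q F 1 =
        coord q F 0 ^ q * coord q F 0 - coord q F 1 ^ q * coord q F 2 := by
      linear_combination form_relation (q := q) (F := F)
    change coord q F 2 ^ q * coord q F 1 ∈ _
    rw [this]
    exact Ideal.sub_mem _ (Ideal.mul_mem_right _ _ (Ideal.pow_mem_pow m0 q))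
      (Ideal.mul_mem_right _ _ (Ideal.pow_mem_pow m1 q))

/-- The equation of the tangent line at `P_∞` vanishes there to order at least `q`. -/
theorem exists_coord_pow_mul_coord_two_mem {b : ℕ} (hb : b ≤ q) (i : Fin 3) :
    ∃ N : ℕ, coord q F i ^ N * coord q F 2 ∈ idealInfty q F ^ b := by
  have m0 : coord q F 0 ∈ idealInfty q F := Ideal.subset_span (by simp)
  have m2 : coord q F 2 ∈ idealInfty q F := Ideal.subset_span (by simp)
  fin_cases i
  · exact ⟨b, Ideal.mul_mem_right _ _ (Ideal.pow_mem_pow m0 b)⟩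
  · refine ⟨q, Ideal.pow_le_pow_right hb ?_⟩
    have : coord q F 1 ^ q * coord q F 2 =
        coord q F 0 ^ q * coord q F 0 - coord q F 2 ^ q * coord q F 1 := by
      linear_combination form_relation (q := q) (F := F)
    change coord q F 1 ^ q * coord q F 2 ∈ _
    rw [this]
    exact Ideal.sub_mem _ (Ideal.mul_mem_right _ _ (Ideal.pow_mem_pow m0 q))
      (Ideal.mul_mem_right _ _ (Ideal.pow_mem_pow m2 q))
  · exact ⟨b, Ideal.mul_mem_right _ _ (Ideal.pow_mem_pow m2 b)⟩

theorem divisorIdeal_zero_right (a : ℕ) : divisorIdeal q F a 0 = idealInfty q F ^ a := by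
  rw [divisorIdeal, Submodule.pow_zero, Ideal.one_eq_top]
  exact Ideal.mul_top _

theorem divisorIdeal_le_infty (a b : ℕ) : divisorIdeal q F a b ≤ idealInfty q F ^ a :=
  Ideal.mul_le_left

theorem divisorIdeal_le_zero (a b : ℕ) : divisorIdeal q F a b ≤ idealZero q F ^ b :=
  Ideal.mul_le_right

/-- The forms of degree `e + 1` vanishing to order `b > e + 1` at `P_0` are the multiples of the
equation of the tangent line. -/
theorem mem_saturatedForms_iff_tangent_zero (hq : q ≠ 0) {e a b : ℕ} (heb : e + 1 < b)
    (hb : b ≤ q) {h : CoordRing q F} :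
    h ∈ saturatedForms (e + 1) (divisorIdeal q F a b) ↔
      ∃ g ∈ saturatedForms e (divisorIdeal q F a 0), h = coord q F 1 * g := by
  rw [divisorIdeal_zero_right]
  constructor
  · rintro ⟨hd, hI⟩
    obtain ⟨N, hN⟩ := hI 2
    obtain ⟨g, hg, rfl⟩ := exists_eq_coord_mul hq (j := 1) (k := 2) (by decide) (by decide)
      (by decide) heb hb hd (divisorIdeal_le_zero a b hN)
    refine ⟨g, ⟨hg, fun i => ?_⟩, rfl⟩
    have m0 : coord q F 0 ∈ idealInfty q F := Ideal.subset_span (by simp)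
    have m2 : coord q F 2 ∈ idealInfty q F := Ideal.subset_span (by simp)
    fin_cases i
    · exact ⟨a, Ideal.mul_mem_right _ _ (Ideal.pow_mem_pow m0 a)⟩
    -- Only `D₊(y)` contains `P_∞`; there `y` is a unit, and the factor `y` is absorbed into the
    -- exponent.
    · obtain ⟨M, hM⟩ := hI 1
      refine ⟨M + 1, ?_⟩
      have := divisorIdeal_le_infty a b hM
      rwa [← mul_assoc, ← pow_succ] at this
    · exact ⟨a, Ideal.mul_mem_right _ _ (Ideal.pow_mem_pow m2 a)⟩
  · rintro ⟨g, ⟨hg, hI⟩, rfl⟩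
    refine ⟨coord_mul_mem_gradedPiece 1 hg, fun i => ?_⟩
    obtain ⟨M, hM⟩ := hI i
    obtain ⟨N, hN⟩ := exists_coord_pow_mul_coord_one_mem (F := F) hb i
    refine ⟨M + N, ?_⟩
    have : coord q F i ^ (M + N) * (coord q F 1 * g) =
        (coord q F i ^ M * g) * (coord q F i ^ N * coord q F 1) := by ring
    rw [this]
    exact Ideal.mul_mem_mul hM hN

/-- The forms of degree `e + 1` vanishing to order `a > e + 1` at `P_∞` are the multiples of the
equation of the tangent line. -/
theorem mem_saturatedForms_iff_tangent_infty (hq : q ≠ 0) {e a : ℕ} (hea : e + 1 < a)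
    (ha : a ≤ q) {h : CoordRing q F} :
    h ∈ saturatedForms (e + 1) (divisorIdeal q F a 0) ↔
      ∃ g ∈ saturatedForms e (divisorIdeal q F 0 0), h = coord q F 2 * g := by
  rw [divisorIdeal_zero_right, divisorIdeal_zero_right, Submodule.pow_zero]
  constructor
  · rintro ⟨hd, hI⟩
    obtain ⟨N, hN⟩ := hI 1
    obtain ⟨g, hg, rfl⟩ := exists_eq_coord_mul hq (j := 2) (k := 1) (by decide) (by decide)
      (by decide) hea ha hd hN
    exact ⟨g, ⟨hg, fun i => ⟨0, by simp⟩⟩, rfl⟩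
  · rintro ⟨g, ⟨hg, -⟩, rfl⟩
    refine ⟨coord_mul_mem_gradedPiece 2 hg, fun i => ?_⟩
    obtain ⟨N, hN⟩ := exists_coord_pow_mul_coord_two_mem (F := F) ha i
    refine ⟨N, ?_⟩
    rw [← mul_assoc]
    exact Ideal.mul_mem_right _ _ hN

/-! ### Values on `B` and comparison of the codes. -/

theorem eval_of_vec_eq_smul {v w : CoordVector q F} {l : F} (hl : v.vec = l • w.vec) {d : ℕ}
    {h : CoordRing q F} (hh : h ∈ gradedPiece q F d) : v.eval h = l ^ d * w.eval h := by
  obtain ⟨p, hp, rfl⟩ := hh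
  change eval v.vec p = l ^ d * eval w.vec p
  rw [hl, eval_smul_of_isHomogeneous hp]

theorem CoordVector.eval_form_eq (v : CoordVector q F) :
    v.vec 1 ^ q * v.vec 2 + v.vec 1 * v.vec 2 ^ q = v.vec 0 ^ (q + 1) := by
  have := v.on_curve
  simp only [form, map_add, map_sub, map_mul, map_pow, eval_X] at this
  exact sub_eq_zero.1 this

/-- Putting `y = 0` in the curve equation forces `x = 0`, leaving only `P_0`, which is not in `B`.
-/
theorem vec_one_ne_zero (hq : q ≠ 0) {P : B q F} {v : CoordVector q F} (hv : v.point = P) :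
    v.vec 1 ≠ 0 := by
  intro h
  have h0 : v.vec 0 = 0 := by
    have := v.eval_form_eq
    rw [h] at this
    simpa [hq] using this.symm
  have h2 : v.vec 2 ≠ 0 := fun h2 => v.ne_zero (by ext i; fin_cases i <;> simp [*])
  refine P.2.2 (Or.inl ?_)
  rw [← hv, CoordVector.point, pZero, Projectivization.mk_eq_mk_iff]
  refine ⟨Units.mk0 _ h2, ?_⟩
  ext i
  fin_cases i <;> simp [h, h0, Units.smul_def]

theorem vec_two_ne_zero (hq : q ≠ 0) {P : B q F} {v : CoordVector q F} (hv : v.point = P) :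
    v.vec 2 ≠ 0 := by
  intro h
  have h0 : v.vec 0 = 0 := by
    have := v.eval_form_eq
    rw [h] at this
    simpa [hq] using this.symm
  have h1 : v.vec 1 ≠ 0 := fun h1 => v.ne_zero (by ext i; fin_cases i <;> simp [*])
  refine P.2.2 (Or.inr ?_)
  rw [Set.mem_singleton_iff, ← hv, CoordVector.point, pInfty, Projectivization.mk_eq_mk_iff]
  refine ⟨Units.mk0 _ h1, ?_⟩
  ext i
  fin_cases i <;> simp [h, h0, Units.smul_def]

/-- If the forms defining one code are the multiples by a fixed `w`, without zeros on `B`, of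
the forms defining another code, then the codes agree up to rescaling. -/
theorem exists_units_code_iff (hq : q ≠ 0) {d a b d' a' b' : ℕ} {w : CoordRing q F}
    (hw : ∀ (P : B q F) (v : CoordVector q F), v.point = P → v.eval w ≠ 0)
    (hS : ∀ h, h ∈ saturatedForms d (divisorIdeal q F a b) ↔
      ∃ g ∈ saturatedForms d' (divisorIdeal q F a' b'), h = w * g)
    {v v' : B q F → CoordVector q F} (hv : ∀ P, (v P).point = P) (hv' : ∀ P, (v' P).point = P) :
    ∃ u : B q F → Fˣ, ∀ c : B q F → F,
      c ∈ code d' a' b' v' ↔ (fun P => (u P : F) * c P) ∈ code d a b v := by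
  have hl (P : B q F) : ∃ l : Fˣ, l • (v' P).vec = (v P).vec := by
    rw [← Projectivization.mk_eq_mk_iff F _ _ (v P).ne_zero (v' P).ne_zero]
    exact (hv P).trans (hv' P).symm
  choose l hl using hl
  have key {g} (hg : g ∈ saturatedForms d' (divisorIdeal q F a' b')) (P : B q F) :
      (v P).eval (w * g) = (l P : F) ^ d * (v' P).eval w * (v' P).eval g := by
    have := ((hS (w * g)).2 ⟨g, hg, rfl⟩).1
    rw [eval_of_vec_eq_smul (hl P).symm this, map_mul, mul_assoc]
  -- The scalar combines the change of coordinate vector in degree `d` with the value of `w` at `v'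
  -- P`.
  refine ⟨fun P => l P ^ d * Units.mk0 _ (hw P _ (hv' P)), fun c => ?_⟩
  rw [mem_code_iff hq, mem_code_iff hq]
  constructor
  · rintro ⟨g, hg, hc⟩
    refine ⟨w * g, (hS _).2 ⟨g, hg, rfl⟩, fun P => ?_⟩
    rw [key hg, hc]
    simp
  · rintro ⟨h, hh, hc⟩
    obtain ⟨g, hg, rfl⟩ := (hS h).1 hh
    refine ⟨g, hg, fun P => ?_⟩
    refine (Units.mul_right_inj (l P ^ d * Units.mk0 _ (hw P _ (hv' P)))).1 ?_
    rw [← hc P, key hg]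
    simp

end Hermitian

end

theorem mainTheorem4 {F : Type*} [Field F] [Fintype F] (q : ℕ) (hq : IsPrimePow q)
    (hF : Fintype.card F = q ^ 2) (d : ℕ) (hd : 2 < d) (a : ℕ → ℕ) (ha : a 1 ≤ a 2)
    (haq : a 2 ≤ q) (r d' : ℕ) (a' : ℕ → ℕ) (hr : r = Hermitian.rIndex d a)
    (hd' : d' = d - 2 + r) (ha' : a' = Hermitian.truncate r a)
    (v v' : Hermitian.B q F → Hermitian.CoordVector q F)
    (hv : ∀ P, (v P).point = P) (hv' : ∀ P, (v' P).point = P) :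
    0 < d' ∧ ∃ u : Hermitian.B q F → Fˣ, ∀ c : Hermitian.B q F → F,
      c ∈ Hermitian.code d' (a' 1) (a' 2) v' ↔
        (fun P => (u P : F) * c P) ∈ Hermitian.code d (a 1) (a 2) v := by
  have hq0 : q ≠ 0 := hq.ne_zero
  refine ⟨by omega, ?_⟩
  -- This removes the truncated subtraction: the thresholds become `a 1 ≤ e + 1` and `a 2 ≤ e + 2`.
  obtain ⟨e, rfl⟩ : ∃ e, d = e + 2 := ⟨d - 2, by omega⟩
  rw [Nat.add_sub_cancel] at hd'
  subst ha' hd'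
  rw [Hermitian.rIndex, Nat.findGreatest_succ, Nat.findGreatest_succ, Nat.findGreatest_zero,
    Nat.add_sub_cancel] at hr
  by_cases h2 : a 2 ≤ e + 2
  · obtain rfl : r = 2 := by rw [hr, if_pos ⟨by norm_num, h2⟩]
    refine Hermitian.exists_units_code_iff hq0 (w := 1) (fun P v _ => by simp) (fun h => ?_) hv hv'
    simp [Hermitian.truncate]
  rw [if_neg (fun h => h2 h.2)] at hr
  by_cases h1 : a 1 ≤ e + 1
  · obtain rfl : r = 1 := by rw [hr, if_pos ⟨by norm_num, h1⟩]
    refine Hermitian.exists_units_code_iff hq0 (w := Hermitian.coord q F 1)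
      (fun P v hv => by
        rw [v.eval_coord]
        exact Hermitian.vec_one_ne_zero hq0 hv) (fun h => ?_) hv hv'
    exact Hermitian.mem_saturatedForms_iff_tangent_zero hq0 (by omega) haq
  · obtain rfl : r = 0 := by rw [hr, if_neg (fun h => h1 h.2)]
    refine Hermitian.exists_units_code_iff hq0
      (w := Hermitian.coord q F 1 * Hermitian.coord q F 2) (fun P v hv => by
        rw [map_mul, v.eval_coord, v.eval_coord]
        exact mul_ne_zero (Hermitian.vec_one_ne_zero hq0 hv) (Hermitian.vec_two_ne_zero hq0 hv))
      (fun h => ?_) hv hv'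
    -- Dividing by `y` lowers the degree to `e + 1`, which is exactly what `a 1 > e + 1` needs for
    -- the division by `z`.
    rw [Hermitian.mem_saturatedForms_iff_tangent_zero hq0 (by omega) haq]
    change _ ↔ ∃ g ∈ Hermitian.saturatedForms e (Hermitian.divisorIdeal q F 0 0), _
    constructor
    · rintro ⟨f, hf, rfl⟩
      obtain ⟨g, hg, rfl⟩ := (Hermitian.mem_saturatedForms_iff_tangent_infty hq0 (by omega)
        (ha.trans haq)).1 hf
      exact ⟨g, hg, (mul_assoc _ _ _).symm⟩
    · rintro ⟨g, hg, rfl⟩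
      exact ⟨_, (Hermitian.mem_saturatedForms_iff_tangent_infty hq0 (by omega)
        (ha.trans haq)).2 ⟨g, hg, rfl⟩, mul_assoc _ _ _⟩
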